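/- Let $G$ be a compact (Hausdorff) topological group, and let $M(G)$ be the Banach algebra of all regular complex Borel measures on $G$, with the total variation norm and with convolution as multiplication, i.e. $\int_G f\,d(\mu*\nu)=\int_G\int_G f(gh)\,d\nu(h)\,d\mu(g)$ for $f\in C(G)$. Through the duality $M(G)=C(G)^*$, $\langle f,\mu\rangle=\int_G f\,d\mu$, the algebra $M(G)$ is a dual Banach algebra with predual $C(G)$ and so carries a $w^*$-topology. Let $\mathcal L^2_{w^*}(M(G),\mathbb C)$ be the Banach space, with the usual norm of bounded bilinear forms, of all bounded bilinear forms $\Phi: M(G)\times M(G)\to\mathbb C$ that are separately $w^*$-continuous. For $a\in M(G)$ and $\Phi\in\mathcal L^2_{w^*}(M(G),\mathbb C)$ put $$(a\cdot\Phi)(\mu,\nu)=\Phi(\mu,\nu*a),\qquad (\Phi\cdot a)(\mu,\nu)=\Phi(a*\mu,\nu)\qquad(\mu,\nu\in M(G)),$$ and, for $\mathrm M\in\mathcal L^2_{w^*}(M(G),\mathbb C)^*$, define $a\cdot\mathrm M,\ \mathrm M\cdot a\in\mathcal L^2_{w^*}(M(G),\mathbb C)^*$ by $$\langle\Phi,a\cdot\mathrm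 M\rangle=\langle\Phi\cdot a,\mathrm M\rangle,\qquad \langle\Phi,\mathrm M\cdot a\rangle=\langle a\cdot\Phi,\mathrm M\rangle .$$ Let $\Delta_{w^*}:\mathcal L^2_{w^*}(M(G),\mathbb C)^*\to M(G)$ be the map such that, for all $f\in C(G)$, $$\int_G f\,d(\Delta_{w^*}\mathrm M)=\langle\Phi_f,\mathrm M\rangle,\qquad\text{where}\quad \Phi_f(\mu,\nu)=\int_G f\,d(\mu*\nu).$$ **Proposition 3.3.** The dual Banach algebra $M(G)$ has a normal, virtual diagonal: there is $\mathrm M\in\mathcal L^2_{w^*}(M(G),\mathbb C)^*$ such that $$a\cdot\mathrm M=\mathrm M\cdot a\quad\text{and}\quad a*\Delta_{w^*}\mathrm M=a\qquad\text{for all } a\in M(G).$$ -/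

import Mathlib

open MeasureTheory Set Filter Topology
open scoped ENNReal NNReal

noncomputable section

section Integral

variable {X : Type*} [MeasurableSpace X]

/-- The integral of a complex function against a complex measure. -/
def cintegral (μ : ComplexMeasure X) (f : X → ℂ) : ℂ :=
  μ.integral f (ContinuousLinearMap.mul ℝ ℂ)

theorem cintegral_add_left {μ ν : ComplexMeasure X} {f : X → ℂ} (hμ : Integrable f μ.variation)
    (hν : Integrable f ν.variation) :
    cintegral (μ + ν) f = cintegral μ f + cintegral ν f :=
  VectorMeasure.integral_add_vectorMeasure hμ hν

theorem cintegral_smul_left (c : ℂ) (μ : ComplexMeasure X) (f : X → ℂ) :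
    cintegral (c • μ) f = c * cintegral μ f := by
  have h1 : c * cintegral μ f = μ.integral f (c • ContinuousLinearMap.mul ℝ ℂ) := by
    by_cases hf : Integrable f μ.variation
    · have := VectorMeasure.continuousLinearMap_apply_integral
        (B := ContinuousLinearMap.mul ℝ ℂ) (C := ContinuousLinearMap.mul ℝ ℂ c) hf
      rw [cintegral]
      exact this
    · rw [cintegral, VectorMeasure.integral_undef hf, VectorMeasure.integral_undef hf, mul_zero]
  have h2 : (c • μ).variation = ‖c‖₊ • μ.variation := VectorMeasure.variation_smul
  have h3 : (c • μ).transpose (ContinuousLinearMap.mul ℝ ℂ)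
      = μ.transpose (c • ContinuousLinearMap.mul ℝ ℂ) := by
    ext s hs x
    change x * (c * μ s) = c * (x * μ s)
    ring
  rw [h1, cintegral, VectorMeasure.integral, VectorMeasure.integral]
  have h4 : DominatedFinMeasAdditive ((‖c‖₊) • μ.variation)
      (μ.transpose (c • ContinuousLinearMap.mul ℝ ℂ)) ‖ContinuousLinearMap.mul ℝ ℂ‖ := by
    rw [← h2, ← h3]; exact dominatedFinMeasAdditive_cbmApplyMeasure _ _
  rw [setToFun_congr_smul_measure' ‖c‖₊ _ h4]
  simp only [h2, h3]

theorem cintegral_add {μ : ComplexMeasure X} {f g : X → ℂ} (hf : Integrable f μ.variation)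
    (hg : Integrable g μ.variation) :
    cintegral μ (fun x => f x + g x) = cintegral μ f + cintegral μ g :=
  VectorMeasure.integral_fun_add hf hg

theorem cintegral_smul (c : ℂ) (μ : ComplexMeasure X) (f : X → ℂ) :
    cintegral μ (fun x => c * f x) = c * cintegral μ f := by
  exact setToFun_smul _ (fun c s x => by
    change (c * x) * μ s = c * (x * μ s)
    ring) c f

theorem norm_cintegral_le (μ : ComplexMeasure X) (f : X → ℂ) :
    ‖cintegral μ f‖ ≤ ∫ x, ‖f x‖ ∂μ.variation := by
  have := VectorMeasure.norm_integral_le_integral_norm (μ := μ) (f := f)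
    (B := ContinuousLinearMap.mul ℝ ℂ)
  simpa [cintegral] using this

theorem cintegral_indicator (μ : ComplexMeasure X) [IsFiniteMeasure μ.variation]
    {s : Set X} (hs : MeasurableSet s) (c : ℂ) :
    cintegral μ (s.indicator fun _ => c) = c * μ s := by
  rw [cintegral, VectorMeasure.integral_indicator_const _ hs]
  rfl

theorem cintegral_withDensity (m : Measure X) [IsFiniteMeasure m] {h : X → ℂ}
    (hh : Integrable h m) {f : X → ℂ} (hf : Integrable f (m.withDensityᵥ h).variation) :
    cintegral (m.withDensityᵥ h) f = ∫ x, f x * h x ∂m := by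
  have hv : (m.withDensityᵥ h).variation = m.withDensity (fun x => ‖h x‖ₑ) :=
    Measure.variation_withDensityᵥ hh
  have hfin : IsFiniteMeasure (m.withDensityᵥ h).variation := by
    rw [hv]; exact ⟨by simpa using! hh.2⟩
  have hae : AEMeasurable (fun x => ‖h x‖ₑ) m := hh.aestronglyMeasurable.enorm
  have hint : ∀ {g : X → ℂ}, Integrable g (m.withDensityᵥ h).variation →
      Integrable (fun x => g x * h x) m := by
    intro g hg
    rw [hv, integrable_withDensity_iff_integrable_smul₀' hae (by simp)] at hg
    have hg' : AEStronglyMeasurable (fun x => g x * h x) m := by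
      have h1 := hg.aestronglyMeasurable
      have h2 : AEStronglyMeasurable (fun x => ((‖h x‖⁻¹ : ℝ) : ℂ) * h x) m := by
        have := hh.aestronglyMeasurable
        exact (Complex.continuous_ofReal.comp_aestronglyMeasurable
          this.norm.aemeasurable.inv.aestronglyMeasurable).mul this
      refine (h1.mul h2).congr (Eventually.of_forall fun x => ?_)
      by_cases hx : h x = 0
      · simp [hx]
      · have : (‖h x‖ : ℂ) ≠ 0 := by simpa using hx
        simp only [toReal_enorm, Complex.real_smul, Complex.ofReal_inv, Pi.mul_apply]
        field_simp
    refine hg.mono hg' (Eventually.of_forall fun x => ?_)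
    simp [mul_comm]
  have hnorm : ∀ g : X → ℂ, ∫ x, ‖g x * h x‖ ∂m = ∫ x, ‖g x‖ ∂(m.withDensityᵥ h).variation := by
    intro g
    rw [hv, integral_withDensity_eq_integral_toReal_smul₀ hae (by simp)]
    simp [mul_comm]
  refine hf.induction (P := fun f => cintegral (m.withDensityᵥ h) f = ∫ x, f x * h x ∂m)
    ?_ ?_ ?_ ?_
  · intro c s hs _
    rw [cintegral_indicator _ hs, withDensityᵥ_apply hh hs, ← integral_const_mul,
      ← integral_indicator hs]
    congr 1
    ext x
    by_cases hx : x ∈ s <;> simp [hx]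
  · intro f g _ hf hg h1 h2
    have := cintegral_add hf hg
    change cintegral _ (fun x => f x + g x) = ∫ x, (f x + g x) * h x ∂m
    rw [this, h1, h2, ← integral_add (hint hf) (hint hg)]
    simp [add_mul]
  · refine isClosed_eq VectorMeasure.continuous_integral ?_
    have : LipschitzWith 1 (fun f : X →₁[(m.withDensityᵥ h).variation] ℂ =>
        ∫ x, f x * h x ∂m) := by
      refine LipschitzWith.of_dist_le_mul fun f g => ?_
      rw [dist_eq_norm, ← integral_sub (hint (L1.integrable_coeFn f)) (hint (L1.integrable_coeFn g)),
        dist_eq_norm, L1.norm_eq_integral_norm]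
      simp only [NNReal.coe_one, one_mul]
      refine (norm_integral_le_integral_norm _).trans (le_of_eq ?_)
      have hfg : ∫ x, ‖(f - g : X →₁[(m.withDensityᵥ h).variation] ℂ) x‖
          ∂(m.withDensityᵥ h).variation = ∫ x, ‖f x - g x‖ ∂(m.withDensityᵥ h).variation := by
        refine integral_congr_ae ?_
        filter_upwards [Lp.coeFn_sub f g] with x hx
        rw [hx]; rfl
      rw [hfg, ← hnorm]
      simp only [sub_mul]
    exact this.continuous
  · intro f g hfg hf hP
    have h1 : cintegral (m.withDensityᵥ h) f = cintegral (m.withDensityᵥ h) g :=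
      VectorMeasure.integral_congr_ae hfg
    rw [← h1, hP]
    have hg : Integrable g (m.withDensityᵥ h).variation := hf.congr hfg
    rw [← sub_eq_zero, ← integral_sub (hint hf) (hint hg), ← norm_le_zero_iff]
    refine (norm_integral_le_integral_norm _).trans (le_of_eq ?_)
    have := hnorm (fun x => f x - g x)
    simp only [sub_mul] at this
    rw [this]
    rw [integral_congr_ae (g := fun _ => 0)]
    · simp
    · filter_upwards [hfg] with x hx
      simp [hx]

end Integral

section Regularity

variable {X : Type*} [TopologicalSpace X] [T2Space X] [MeasurableSpace X] [BorelSpace X]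

theorem regular_of_absolutelyContinuous {μ ν : Measure X} [IsFiniteMeasure μ]
    [IsFiniteMeasure ν] [μ.Regular] (h : ν ≪ μ) : ν.Regular := by
  have : ν.InnerRegularCompactLTTop := by
    constructor
    rintro s ⟨hs, -⟩ r hr
    have hK : ∀ n : ℕ, ∃ K ⊆ s, IsCompact K ∧ μ (s \ K) < ((n : ℝ≥0∞) + 1)⁻¹ := fun n =>
      hs.exists_isCompact_sdiff_lt (measure_ne_top μ s) (by simp)
    choose K hKs hKc hKμ using hK
    have h0 : μ (s \ ⋃ n, K n) = 0 := by
      refine le_antisymm (le_of_forall_pos_le_add fun ε hε => ?_) bot_le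
      obtain ⟨n, hn⟩ := ENNReal.exists_inv_nat_lt hε.ne'
      calc μ (s \ ⋃ n, K n) ≤ μ (s \ K n) := by
            gcongr; exact subset_iUnion K n
        _ ≤ ((n : ℝ≥0∞) + 1)⁻¹ := (hKμ n).le
        _ ≤ (n : ℝ≥0∞)⁻¹ := by gcongr; exact le_self_add
        _ ≤ 0 + ε := by simpa using hn.le
    have h1 : ν s = ⨆ n, ν (accumulate K n) := by
      rw [← measure_iUnion_eq_iSup_accumulate]
      refine le_antisymm ?_ (measure_mono (iUnion_subset hKs))
      calc ν s ≤ ν ((⋃ n, K n) ∪ (s \ ⋃ n, K n)) := by gcongr; simp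
        _ ≤ ν (⋃ n, K n) + ν (s \ ⋃ n, K n) := measure_union_le _ _
        _ = ν (⋃ n, K n) := by rw [h h0, add_zero]
    rw [h1, lt_iSup_iff] at hr
    obtain ⟨n, hn⟩ := hr
    refine ⟨accumulate K n, ?_, ?_, hn⟩
    · simp only [accumulate_def]
      exact iUnion₂_subset fun i _ => hKs i
    · simp only [accumulate_def]
      exact (finite_le_nat n).isCompact_biUnion fun i _ => hKc i
  infer_instance

end Regularity
section MeasureSpace

variable (X : Type*) [TopologicalSpace X] [CompactSpace X] [T2Space X]
  [MeasurableSpace X] [BorelSpace X]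

/-- The regular complex Borel measures on a compact Hausdorff space, i.e. the complex measures
whose total variation is a regular (hence finite) measure. -/
def regularComplexMeasures : Submodule ℂ (ComplexMeasure X) where
  carrier := {μ | μ.variation.Regular}
  add_mem' {μ ν} (hμ : μ.variation.Regular) (hν : ν.variation.Regular) := by
    have hfin : IsFiniteMeasure (μ.variation + ν.variation) := inferInstance
    have : (μ.variation + ν.variation).InnerRegular := inferInstance
    have h : (μ + ν).variation ≤ μ.variation + ν.variation := VectorMeasure.variation_add_le
    have : IsFiniteMeasure (μ + ν).variation := isFiniteMeasure_of_le _ h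
    have : (μ.variation + ν.variation).Regular := inferInstance
    exact regular_of_absolutelyContinuous (Measure.absolutelyContinuous_of_le h)
  zero_mem' := by
    change (0 : ComplexMeasure X).variation.Regular
    rw [VectorMeasure.variation_zero]; infer_instance
  smul_mem' c μ (hμ : μ.variation.Regular) := by
    change (c • μ).variation.Regular
    rw [VectorMeasure.variation_smul]; infer_instance

/-- The space `M(X)` of regular complex Borel measures on `X`. -/
def MeasureAlgebra : Type _ := regularComplexMeasures X

namespace MeasureAlgebra

instance : AddCommGroup (MeasureAlgebra X) :=
  inferInstanceAs (AddCommGroup (regularComplexMeasures X))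

instance : Module ℂ (MeasureAlgebra X) :=
  inferInstanceAs (Module ℂ (regularComplexMeasures X))

variable {X}

/-- The underlying complex measure of an element of `M(X)`. -/
def toMeasure (μ : MeasureAlgebra X) : ComplexMeasure X := Subtype.val μ

/-- The total variation measure `|μ|`. -/
def tv (μ : MeasureAlgebra X) : Measure X := μ.toMeasure.variation

instance (μ : MeasureAlgebra X) : μ.tv.Regular := Subtype.property μ

instance (μ : MeasureAlgebra X) : IsFiniteMeasure μ.tv := inferInstance

instance (μ : MeasureAlgebra X) : IsFiniteMeasure μ.toMeasure.variation :=
  inferInstanceAs (IsFiniteMeasure μ.tv)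

/-- The total variation norm `‖μ‖ = |μ|(X)`. -/
instance : Norm (MeasureAlgebra X) := ⟨fun μ => μ.tv.real univ⟩

theorem norm_def (μ : MeasureAlgebra X) : ‖μ‖ = μ.tv.real univ := rfl

theorem normCore : NormedSpace.Core ℂ (MeasureAlgebra X) where
  norm_nonneg _ := measureReal_nonneg
  norm_smul c μ := by
    have h : (c • μ).tv = ‖c‖₊ • μ.tv := VectorMeasure.variation_smul
    rw [norm_def, norm_def, h]
    simp
  norm_triangle μ ν := by
    have h : (μ + ν).tv ≤ μ.tv + ν.tv := VectorMeasure.variation_add_le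
    rw [norm_def, norm_def, norm_def, ← measureReal_add_apply]
    exact ENNReal.toReal_mono (measure_ne_top _ _) (h univ)
  norm_eq_zero_iff μ := by
    rw [norm_def, measureReal_def, ENNReal.toReal_eq_zero_iff]
    simp only [measure_ne_top, or_false, Measure.measure_univ_eq_zero]
    rw [tv, VectorMeasure.variation_eq_zero]
    exact ⟨fun h => Subtype.ext h, fun h => by rw [h]; rfl⟩

instance : NormedAddCommGroup (MeasureAlgebra X) := NormedAddCommGroup.ofCore normCore

instance : NormedSpace ℂ (MeasureAlgebra X) := NormedSpace.ofCore normCore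

theorem integrable_tv (μ : MeasureAlgebra X) (f : C(X, ℂ)) :
    Integrable f μ.toMeasure.variation :=
  f.continuous.integrable_of_hasCompactSupport (HasCompactSupport.of_compactSpace _)

theorem norm_cintegral_le_norm (μ : MeasureAlgebra X) (f : C(X, ℂ)) :
    ‖cintegral μ.toMeasure f‖ ≤ ‖μ‖ * ‖f‖ := by
  refine (norm_cintegral_le _ _).trans ?_
  have h : ∫ x, ‖f x‖ ∂μ.tv ≤ ∫ _, ‖f‖ ∂μ.tv :=
    integral_mono (μ.integrable_tv f).norm (integrable_const _) fun x => f.norm_coe_le_norm x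
  simpa [norm_def, tv] using h

variable (X) in
/-- The canonical pairing `⟨f, μ⟩ = ∫ f dμ` of `M(X)` with `C(X)`. -/
def toDual : MeasureAlgebra X →ₗ[ℂ] StrongDual ℂ C(X, ℂ) where
  toFun μ := LinearMap.mkContinuous
    { toFun := fun f => cintegral μ.toMeasure f
      map_add' := fun f g => cintegral_add (μ.integrable_tv f) (μ.integrable_tv g)
      map_smul' := fun c f => cintegral_smul c μ.toMeasure f } ‖μ‖ (norm_cintegral_le_norm μ)
  map_add' μ ν := ContinuousLinearMap.ext fun f =>
    cintegral_add_left (μ.integrable_tv f) (ν.integrable_tv f)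
  map_smul' c μ := ContinuousLinearMap.ext fun f => cintegral_smul_left c μ.toMeasure f

theorem toDual_apply (μ : MeasureAlgebra X) (f : C(X, ℂ)) :
    toDual X μ f = cintegral μ.toMeasure f := rfl

theorem norm_toDual_le (μ : MeasureAlgebra X) : ‖toDual X μ‖ ≤ ‖μ‖ :=
  ContinuousLinearMap.opNorm_le_bound _ (norm_nonneg _) (norm_cintegral_le_norm μ)

/-- Radial retraction of the plane onto the closed unit disc. -/
def retract (z : ℂ) : ℂ := ((max 1 ‖z‖)⁻¹ : ℝ) * z

theorem continuous_retract : Continuous retract := by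
  unfold retract
  refine (Complex.continuous_ofReal.comp ?_).mul continuous_id
  exact (continuous_const.max continuous_norm).inv₀ fun z => by positivity

theorem norm_retract_le (z : ℂ) : ‖retract z‖ ≤ 1 := by
  have h : 0 < max 1 ‖z‖ := by positivity
  rw [retract, norm_mul, Complex.norm_real, Real.norm_of_nonneg (by positivity),
    inv_mul_le_iff₀ h, mul_one]
  exact le_max_right _ _

theorem norm_retract_sub_le (z w : ℂ) (hw : ‖w‖ ≤ 1) : ‖w - retract z‖ ≤ 2 * ‖w - z‖ := by
  have h1 : ‖z - retract z‖ ≤ ‖w - z‖ := by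
    rcases le_total ‖z‖ 1 with h | h
    · simp [retract, max_eq_left h]
    · have h0 : 0 < ‖z‖ := by linarith
      have : z - retract z = ((1 - ‖z‖⁻¹ : ℝ) : ℂ) * z := by
        rw [retract, max_eq_right h]; push_cast; ring
      rw [this, norm_mul, Complex.norm_real, Real.norm_of_nonneg
        (sub_nonneg.2 (inv_le_one_of_one_le₀ h)), sub_mul, inv_mul_cancel₀ h0.ne', one_mul]
      have := norm_sub_norm_le z w
      rw [norm_sub_rev] at this
      linarith
  calc ‖w - retract z‖ = ‖(w - z) + (z - retract z)‖ := by congr 1; ring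
    _ ≤ ‖w - z‖ + ‖z - retract z‖ := norm_add_le _ _
    _ ≤ 2 * ‖w - z‖ := by linarith

theorem le_norm_toDual (μ : MeasureAlgebra X) : ‖μ‖ ≤ ‖toDual X μ‖ := by
  classical
  refine le_of_forall_pos_le_add fun ε hε => ?_
  set m := μ.toMeasure with hm
  have : m.variation.Regular := inferInstanceAs μ.tv.Regular
  obtain ⟨P, -, hdisj, hmeas, hP⟩ := m.exists_variation_le_add MeasurableSet.univ
    (ε := (ε / 2).toNNReal) (by simpa using hε) (measure_ne_top _ _)
  -- the simple function `∑ p, conj (sign (m p)) 1_p`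
  let c : Set X → ℂ := fun p => ((‖m p‖⁻¹ : ℝ) : ℂ) * (starRingEnd ℂ) (m p)
  let g : X → ℂ := fun x => ∑ p ∈ P, p.indicator (fun _ => c p) x
  have hc : ∀ p, ‖c p‖ ≤ 1 := fun p => by
    simp only [c, norm_mul, Complex.norm_real, norm_inv, norm_norm, RCLike.norm_conj]
    exact inv_mul_le_one
  have hcm : ∀ p, c p * m p = (‖m p‖ : ℂ) := fun p => by
    by_cases hp : m p = 0
    · simp [hp]
    · have h0 : (‖m p‖ : ℂ) ≠ 0 := by simpa using hp
      simp only [c, mul_assoc, mul_comm ((starRingEnd ℂ) (m p)), Complex.mul_conj']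
      push_cast
      field_simp
  have hgint : Integrable g m.variation :=
    integrable_finsetSum _ fun p hp => (integrable_const _).indicator (hmeas p hp)
  have hgi : cintegral m g = ((∑ p ∈ P, ‖m p‖ : ℝ) : ℂ) := by
    have : cintegral m g = ∑ p ∈ P, cintegral m (p.indicator fun _ => c p) :=
      VectorMeasure.integral_finsetSum P
        (fun p hp => (integrable_const _).indicator (hmeas p hp))
    rw [this]
    push_cast
    refine Finset.sum_congr rfl fun p hp => ?_
    rw [cintegral_indicator _ (hmeas p hp), hcm]
  have hg1 : ∀ x, ‖g x‖ ≤ 1 := by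
    intro x
    by_cases hx : ∃ p ∈ P, x ∈ p
    · obtain ⟨p, hp, hxp⟩ := hx
      have : g x = c p := by
        simp only [g]
        rw [Finset.sum_eq_single p]
        · simp [hxp]
        · intro q hq hqp
          have := hdisj hq hp hqp
          exact indicator_of_notMem (fun hxq => (Set.disjoint_left.1 this) hxq hxp) _
        · exact fun h => absurd hp h
      rw [this]; exact hc p
    · have : g x = 0 := Finset.sum_eq_zero fun p hp =>
        indicator_of_notMem (fun hxp => hx ⟨p, hp, hxp⟩) _
      simp [this]
  obtain ⟨f, hf, hfint⟩ := hgint.exists_boundedContinuous_integral_sub_le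
    (ε := ε / 4) (by positivity)
  let F : C(X, ℂ) := ⟨fun x => retract (f x), continuous_retract.comp f.continuous⟩
  have hF : ‖F‖ ≤ 1 := (ContinuousMap.norm_le _ zero_le_one).2 fun x => norm_retract_le _
  have hFint : Integrable F m.variation := μ.integrable_tv F
  have hdiff : ‖cintegral m g - toDual X μ F‖ ≤ ε / 2 := by
    have h1 : cintegral m g - toDual X μ F = cintegral m (fun x => g x - F x) :=
      (VectorMeasure.integral_fun_sub hgint hFint).symm
    rw [h1]
    refine (norm_cintegral_le _ _).trans ?_
    calc ∫ x, ‖g x - F x‖ ∂m.variation ≤ ∫ x, 2 * ‖g x - f x‖ ∂m.variation :=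
          integral_mono (hgint.sub hFint).norm ((hgint.sub hfint).norm.const_mul 2)
            fun x => norm_retract_sub_le _ _ (hg1 x)
      _ = 2 * ∫ x, ‖g x - f x‖ ∂m.variation := integral_const_mul _ _
      _ ≤ ε / 2 := by linarith
  have hsum : ‖μ‖ ≤ ∑ p ∈ P, ‖m p‖ + ε / 2 := by
    have h2 : ∑ p ∈ P, ‖m p‖ₑ + ((ε / 2).toNNReal : ℝ≥0∞)
        = ENNReal.ofReal (∑ p ∈ P, ‖m p‖ + ε / 2) := by
      rw [ENNReal.ofReal_add (Finset.sum_nonneg fun _ _ => norm_nonneg _) (by positivity),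
        ENNReal.ofReal_sum_of_nonneg fun _ _ => norm_nonneg _]
      simp [ENNReal.ofReal, enorm_eq_nnnorm]
    rw [h2] at hP
    exact ENNReal.toReal_le_of_le_ofReal
      (add_nonneg (Finset.sum_nonneg fun _ _ => norm_nonneg _) (by positivity)) hP
  have h3 : ∑ p ∈ P, ‖m p‖ = ‖cintegral m g‖ := by
    rw [hgi, Complex.norm_real, Real.norm_of_nonneg (Finset.sum_nonneg fun _ _ => norm_nonneg _)]
  have h4 : ‖cintegral m g‖ ≤ ‖toDual X μ F‖ + ε / 2 := by
    have := norm_sub_norm_le (cintegral m g) (toDual X μ F)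
    linarith
  have h5 : ‖toDual X μ F‖ ≤ ‖toDual X μ‖ := (toDual X μ).unit_le_opNorm F hF
  linarith

theorem norm_toDual (μ : MeasureAlgebra X) : ‖toDual X μ‖ = ‖μ‖ :=
  le_antisymm (norm_toDual_le μ) (le_norm_toDual μ)

end MeasureAlgebra

end MeasureSpace
section RieszRepresentation

variable {X : Type*} [TopologicalSpace X] [CompactSpace X]

/-- For a bounded functional `φ` on `C(X)` and `f ≥ 0`, the number
`|φ|(f) = sup { |φ g| : |g| ≤ f }`. -/
def absFunctional (φ : StrongDual ℂ C(X, ℂ)) (f : C(X, ℝ≥0)) : ℝ :=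
  ⨆ g : {g : C(X, ℂ) // ∀ x, ‖g x‖ ≤ f x}, ‖φ g.1‖

theorem absFunctional_bdd (φ : StrongDual ℂ C(X, ℂ)) (f : C(X, ℝ≥0)) :
    BddAbove (range fun g : {g : C(X, ℂ) // ∀ x, ‖g x‖ ≤ f x} => ‖φ g.1‖) := by
  let F : C(X, ℝ) := ⟨fun x => f x, by fun_prop⟩
  refine ⟨‖φ‖ * ‖F‖, ?_⟩
  rintro _ ⟨⟨g, hg⟩, rfl⟩
  refine (φ.le_opNorm g).trans ?_
  gcongr
  refine (ContinuousMap.norm_le _ (norm_nonneg _)).2 fun x => (hg x).trans ?_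
  have := F.norm_coe_le_norm x
  simpa [F] using this

theorem le_absFunctional (φ : StrongDual ℂ C(X, ℂ)) (f : C(X, ℝ≥0)) (g : C(X, ℂ))
    (hg : ∀ x, ‖g x‖ ≤ f x) : ‖φ g‖ ≤ absFunctional φ f :=
  le_ciSup (absFunctional_bdd φ f) ⟨g, hg⟩

instance (f : C(X, ℝ≥0)) : Nonempty {g : C(X, ℂ) // ∀ x, ‖g x‖ ≤ f x} :=
  ⟨⟨0, fun x => by simp⟩⟩

theorem absFunctional_nonneg (φ : StrongDual ℂ C(X, ℂ)) (f : C(X, ℝ≥0)) :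
    0 ≤ absFunctional φ f :=
  (norm_nonneg (φ 0)).trans (le_absFunctional φ f 0 fun x => by simp)

theorem exists_rotate (φ : StrongDual ℂ C(X, ℂ)) (g : C(X, ℂ)) :
    ∃ c : ℂ, ‖c‖ ≤ 1 ∧ φ (c • g) = (‖φ g‖ : ℂ) := by
  refine ⟨((‖φ g‖⁻¹ : ℝ) : ℂ) * (starRingEnd ℂ) (φ g), ?_, ?_⟩
  · simp only [norm_mul, Complex.norm_real, norm_inv, norm_norm, RCLike.norm_conj]
    exact inv_mul_le_one
  · by_cases hp : φ g = 0
    · simp [hp]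
    · have h0 : (‖φ g‖ : ℂ) ≠ 0 := by simpa using hp
      rw [map_smul, smul_eq_mul, mul_assoc, mul_comm ((starRingEnd ℂ) (φ g)), Complex.mul_conj']
      push_cast
      field_simp

theorem absFunctional_add (φ : StrongDual ℂ C(X, ℂ)) (f₁ f₂ : C(X, ℝ≥0)) :
    absFunctional φ (f₁ + f₂) = absFunctional φ f₁ + absFunctional φ f₂ := by
  refine le_antisymm ?_ ?_
  · refine ciSup_le fun ⟨g, hg⟩ => le_of_forall_pos_le_add fun ε hε => ?_
    set δ : ℝ := ε / (‖φ‖ + 1) with hδ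
    have hδ0 : 0 < δ := by positivity
    have hpos : ∀ x, 0 < (f₁ x : ℝ) + f₂ x + δ := fun x => by positivity
    let w : C(X, ℝ≥0) → C(X, ℂ) := fun f =>
      ⟨fun x => (((f x : ℝ) / ((f₁ x : ℝ) + f₂ x + δ) : ℝ) : ℂ) * g x, by
        refine (Complex.continuous_ofReal.comp (Continuous.div ?_ ?_ fun x => (hpos x).ne')).mul
          g.continuous <;> fun_prop⟩
    have hw : ∀ f : C(X, ℝ≥0), ∀ x, ‖w f x‖ ≤ f x := by
      intro f x
      change ‖(((f x : ℝ) / ((f₁ x : ℝ) + f₂ x + δ) : ℝ) : ℂ) * g x‖ ≤ f x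
      have hgx : ‖g x‖ ≤ (f₁ x : ℝ) + f₂ x + δ := by
        have := hg x
        simp only [ContinuousMap.add_apply, NNReal.coe_add] at this
        linarith
      rw [norm_mul, Complex.norm_real, Real.norm_of_nonneg (by have := hpos x; positivity)]
      calc (f x : ℝ) / ((f₁ x : ℝ) + f₂ x + δ) * ‖g x‖
          ≤ (f x : ℝ) / ((f₁ x : ℝ) + f₂ x + δ) * ((f₁ x : ℝ) + f₂ x + δ) :=
            mul_le_mul_of_nonneg_left hgx (div_nonneg (f x).coe_nonneg (hpos x).le)
        _ = f x := div_mul_cancel₀ _ (hpos x).ne'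
    have hrest : ‖g - w f₁ - w f₂‖ ≤ δ := by
      refine (ContinuousMap.norm_le _ hδ0.le).2 fun x => ?_
      have hx := hpos x
      have e : (g - w f₁ - w f₂) x = ((δ / ((f₁ x : ℝ) + f₂ x + δ) : ℝ) : ℂ) * g x := by
        change g x - (((f₁ x : ℝ) / ((f₁ x : ℝ) + f₂ x + δ) : ℝ) : ℂ) * g x -
          (((f₂ x : ℝ) / ((f₁ x : ℝ) + f₂ x + δ) : ℝ) : ℂ) * g x = _
        have : ((((f₁ x : ℝ) + f₂ x + δ) : ℝ) : ℂ) ≠ 0 := by exact_mod_cast hx.ne'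
        push_cast at this ⊢
        field_simp
        ring
      rw [e, norm_mul, Complex.norm_real, Real.norm_of_nonneg (by positivity), div_mul_eq_mul_div,
        div_le_iff₀ hx]
      have := hg x
      simp only [ContinuousMap.add_apply, NNReal.coe_add] at this
      gcongr
      linarith
    have e : φ g = φ (w f₁) + φ (w f₂) + φ (g - w f₁ - w f₂) := by
      rw [← map_add, ← map_add]; congr 1; abel
    have h1 := le_absFunctional φ f₁ _ (hw f₁)
    have h2 := le_absFunctional φ f₂ _ (hw f₂)
    have h3 : ‖φ (g - w f₁ - w f₂)‖ ≤ ε := by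
      refine (φ.le_opNorm _).trans ?_
      calc ‖φ‖ * ‖g - w f₁ - w f₂‖ ≤ (‖φ‖ + 1) * δ := by gcongr; linarith
        _ = ε := by rw [hδ]; field_simp
    change ‖φ g‖ ≤ _
    rw [e]
    refine (norm_add₃_le).trans ?_
    linarith
  · rw [← le_sub_iff_add_le]
    refine ciSup_le fun ⟨g₁, hg₁⟩ => ?_
    rw [le_sub_comm]
    refine ciSup_le fun ⟨g₂, hg₂⟩ => ?_
    rw [le_sub_iff_add_le, add_comm]
    obtain ⟨c₁, hc₁, h₁⟩ := exists_rotate φ g₁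
    obtain ⟨c₂, hc₂, h₂⟩ := exists_rotate φ g₂
    have h := le_absFunctional φ (f₁ + f₂) (c₁ • g₁ + c₂ • g₂) fun x => by
      simp only [ContinuousMap.add_apply, ContinuousMap.smul_apply, smul_eq_mul, NNReal.coe_add]
      refine (norm_add_le _ _).trans ?_
      rw [norm_mul, norm_mul]
      have a := hg₁ x
      have b := hg₂ x
      have := mul_le_of_le_one_left (norm_nonneg (g₁ x)) hc₁
      have := mul_le_of_le_one_left (norm_nonneg (g₂ x)) hc₂
      linarith
    rw [map_add, h₁, h₂, ← Complex.ofReal_add, Complex.norm_real,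
      Real.norm_of_nonneg (by positivity)] at h
    exact h

theorem absFunctional_smul_le (φ : StrongDual ℂ C(X, ℂ)) (c : ℝ≥0) (f : C(X, ℝ≥0)) :
    c * absFunctional φ f ≤ absFunctional φ (c • f) := by
  rw [absFunctional, Real.mul_iSup_of_nonneg c.coe_nonneg]
  refine ciSup_le fun ⟨g, hg⟩ => ?_
  have h := le_absFunctional φ (c • f) (((c : ℝ) : ℂ) • g) fun x => by
    simp only [ContinuousMap.smul_apply, norm_smul, Complex.norm_real]
    simpa using mul_le_mul_of_nonneg_left (hg x) c.2
  simpa [norm_smul] using h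

theorem absFunctional_smul (φ : StrongDual ℂ C(X, ℂ)) (c : ℝ≥0) (f : C(X, ℝ≥0)) :
    absFunctional φ (c • f) = c * absFunctional φ f := by
  rcases eq_or_ne c 0 with rfl | hc
  · have h := absFunctional_add φ 0 0
    simp only [add_zero] at h
    simp only [zero_smul, NNReal.coe_zero, zero_mul]
    linarith
  · refine le_antisymm ?_ (absFunctional_smul_le φ c f)
    have h := absFunctional_smul_le φ c⁻¹ (c • f)
    rw [smul_smul, inv_mul_cancel₀ hc, one_smul, NNReal.coe_inv] at h
    have : (0 : ℝ) < c := by positivity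
    rwa [inv_mul_le_iff₀ this] at h

variable [T2Space X] [MeasurableSpace X] [BorelSpace X]

theorem exists_dominating_measure (φ : StrongDual ℂ C(X, ℂ)) :
    ∃ m : Measure X, IsFiniteMeasure m ∧ m.Regular ∧
      ∀ g : C(X, ℂ), ‖φ g‖ ≤ ∫ x, ‖g x‖ ∂m := by
  let Λ : CompactlySupportedContinuousMap X ℝ≥0 →ₗ[ℝ≥0] ℝ≥0 :=
    { toFun := fun f => ⟨absFunctional φ f.toContinuousMap, absFunctional_nonneg _ _⟩
      map_add' := fun f g => NNReal.eq (absFunctional_add φ f.toContinuousMap g.toContinuousMap)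
      map_smul' := fun c f => NNReal.eq (absFunctional_smul φ c f.toContinuousMap) }
  refine ⟨NNRealRMK.rieszMeasure Λ, inferInstance, inferInstance, fun g => ?_⟩
  let f : CompactlySupportedContinuousMap X ℝ≥0 :=
    { toFun := fun x => ‖g x‖₊
      continuous_toFun := by fun_prop
      hasCompactSupport' := HasCompactSupport.of_compactSpace _ }
  have h := NNRealRMK.integral_rieszMeasure Λ f
  have h1 : ‖φ g‖ ≤ (Λ f : ℝ) := le_absFunctional φ f.toContinuousMap g fun x => le_rfl
  rw [← h] at h1
  exact h1

/-- A bounded functional on `C(X)` has an integrable density with respect to a finite regular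
measure. -/
theorem exists_density (φ : StrongDual ℂ C(X, ℂ)) :
    ∃ (m : Measure X) (h : X → ℂ), IsFiniteMeasure m ∧ m.Regular ∧ Integrable h m ∧
      ∀ f : C(X, ℂ), φ f = ∫ x, f x * h x ∂m := by
  obtain ⟨m, hfin, hreg, hm⟩ := exists_dominating_measure φ
  let e : C(X, ℂ) →L[ℂ] Lp ℂ 2 m := ContinuousMap.toLp 2 m ℂ
  have hdense : DenseRange e := ContinuousMap.toLp_denseRange ℂ m ℂ (by simp)
  have hbound : ∃ C, ∀ g, ‖φ.toLinearMap g‖ ≤ C * ‖e.toLinearMap g‖ := by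
    refine ⟨(m univ ^ (1 / 2 : ℝ)).toReal, fun g => ?_⟩
    have h1 := eLpNorm_le_eLpNorm_mul_rpow_measure_univ (μ := m) (p := 1) (q := 2) (by simp)
      (g.continuous.aestronglyMeasurable (μ := m))
    have h2 : ‖e g‖ = (eLpNorm g 2 m).toReal := by
      rw [Lp.norm_def]
      congr 1
      exact eLpNorm_congr_ae (ContinuousMap.coeFn_toLp m g)
    have hgi : Integrable g m :=
      g.continuous.integrable_of_hasCompactSupport (HasCompactSupport.of_compactSpace _)
    have h3 : ∫ x, ‖g x‖ ∂m = (eLpNorm g 1 m).toReal := by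
      rw [eLpNorm_one_eq_lintegral_enorm, integral_norm_eq_lintegral_enorm hgi.1]
    have h4 : eLpNorm g 2 m ≠ ∞ := by
      have := Lp.eLpNorm_ne_top (e g)
      rwa [eLpNorm_congr_ae (ContinuousMap.coeFn_toLp m g)] at this
    have h5 : (m univ ^ (1 / 2 : ℝ)) ≠ ∞ := ENNReal.rpow_ne_top_of_nonneg (by norm_num)
      (measure_ne_top _ _)
    refine (hm g).trans ?_
    change _ ≤ _ * ‖e g‖
    rw [h3, h2, mul_comm, ← ENNReal.toReal_mul]
    refine ENNReal.toReal_mono (ENNReal.mul_ne_top h4 h5) (h1.trans (le_of_eq ?_))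
    norm_num
  let Φ : Lp ℂ 2 m →L[ℂ] ℂ := φ.toLinearMap.extendOfNorm e.toLinearMap
  let h := (InnerProductSpace.toDual ℂ (Lp ℂ 2 m)).symm Φ
  refine ⟨m, fun x => (starRingEnd ℂ) (h x), hfin, hreg, ?_, fun f => ?_⟩
  · have : Integrable h m := (Lp.memLp h).integrable (by norm_num)
    exact (RCLike.conjCLE (K := ℂ)).toContinuousLinearMap.integrable_comp this
  · have h1 : Φ (e f) = φ f := LinearMap.extendOfNorm_eq hdense hbound f
    rw [← h1, ← InnerProductSpace.toDual_symm_apply (𝕜 := ℂ), L2.inner_def]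
    refine integral_congr_ae ?_
    filter_upwards [ContinuousMap.coeFn_toLp (𝕜 := ℂ) (p := 2) m f] with x hx
    rw [hx]
    simp [h, RCLike.inner_apply]

namespace MeasureAlgebra

theorem toDual_surjective : Function.Surjective (toDual X) := by
  intro φ
  obtain ⟨m, h, hfin, hreg, hh, hφ⟩ := exists_density φ
  have hv : (m.withDensityᵥ h).variation = m.withDensity (fun x => ‖h x‖ₑ) :=
    Measure.variation_withDensityᵥ hh
  have hfin' : IsFiniteMeasure (m.withDensityᵥ h).variation := by
    rw [hv]; exact ⟨by simpa using! hh.2⟩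
  have hr : (m.withDensityᵥ h).variation.Regular := by
    refine regular_of_absolutelyContinuous (μ := m) ?_
    rw [hv]; exact withDensity_absolutelyContinuous _ _
  let μ : MeasureAlgebra X := ⟨m.withDensityᵥ h, hr⟩
  refine ⟨μ, ContinuousLinearMap.ext fun f => ?_⟩
  rw [toDual_apply, hφ]
  exact cintegral_withDensity m hh (μ.integrable_tv f)

variable (X) in
/-- The Riesz representation theorem: `M(X) = C(X)^*` isometrically, via integration. -/
def riesz : MeasureAlgebra X ≃ₗᵢ[ℂ] StrongDual ℂ C(X, ℂ) :=
  LinearIsometryEquiv.ofSurjective ⟨toDual X, norm_toDual⟩ toDual_surjective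

theorem riesz_apply (μ : MeasureAlgebra X) (f : C(X, ℂ)) :
    riesz X μ f = cintegral μ.toMeasure f := rfl

instance : CompleteSpace (MeasureAlgebra X) :=
  (riesz X).symm.isometry.isUniformInducing.completeSpace_congr (riesz X).symm.surjective |>.1
    inferInstance

end MeasureAlgebra

end RieszRepresentation
section DualBanachAlgebras

/- Shortcut instances for the norm of a submodule of a space of operators. -/
instance submoduleDualSeminormed (A : Type*) [NormedAddCommGroup A] [NormedSpace ℂ A]
    (P : Submodule ℂ (StrongDual ℂ A)) : SeminormedAddCommGroup P :=
  inferInstance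

instance submoduleDualNormedSpace (A : Type*) [NormedAddCommGroup A] [NormedSpace ℂ A]
    (P : Submodule ℂ (StrongDual ℂ A)) : NormedSpace ℂ P :=
  inferInstance

instance submoduleFormsSeminormed (A : Type*) [NormedAddCommGroup A] [NormedSpace ℂ A]
    (P : Submodule ℂ (A →L[ℂ] A →L[ℂ] ℂ)) : SeminormedAddCommGroup P :=
  Submodule.seminormedAddCommGroup (𝕜 := ℂ) (E := A →L[ℂ] A →L[ℂ] ℂ) P

instance submoduleFormsNormedSpace (A : Type*) [NormedAddCommGroup A] [NormedSpace ℂ A]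
    (P : Submodule ℂ (A →L[ℂ] A →L[ℂ] ℂ)) : NormedSpace ℂ P :=
  Submodule.normedSpace (𝕜 := ℂ) (R := ℂ) (E := A →L[ℂ] A →L[ℂ] ℂ) P

/-- A dual Banach algebra: a Banach algebra `A` with a fixed closed submodule `A_*` (`predual`) of
the dual Banach `A`-bimodule `A^*` such that `A = (A_*)^*`, i.e. such that the canonical map from
`A` into the dual of `A_*` is an isometric isomorphism. -/
class DualBanachAlgebra (A : Type*) [NonUnitalNormedRing A] [NormedSpace ℂ A]
    [IsScalarTower ℂ A A] [SMulCommClass ℂ A A] where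
  predual : Submodule ℂ (StrongDual ℂ A)
  isClosed_predual : IsClosed (predual : Set (StrongDual ℂ A))
  comp_mulLeft_mem : ∀ φ ∈ predual, ∀ a : A, φ ∘L ContinuousLinearMap.mul ℂ A a ∈ predual
  comp_mulRight_mem : ∀ φ ∈ predual, ∀ a : A,
    φ ∘L (ContinuousLinearMap.mul ℂ A).flip a ∈ predual
  norm_eval : ∀ a : A,
    ‖(NormedSpace.inclusionInDoubleDual ℂ A a) ∘L predual.subtypeL‖ = ‖a‖
  eval_surjective : ∀ ψ : StrongDual ℂ predual,
    ∃ a : A, (NormedSpace.inclusionInDoubleDual ℂ A a) ∘L predual.subtypeL = ψ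

namespace DualBanachAlgebra

variable (A : Type*) [NonUnitalNormedRing A] [NormedSpace ℂ A]
    [IsScalarTower ℂ A A] [SMulCommClass ℂ A A] [DualBanachAlgebra A]

/-- The identification `A = (A_*)^*`. -/
def equivDual : A ≃ₗᵢ[ℂ] StrongDual ℂ (predual (A := A)) :=
  LinearIsometryEquiv.ofSurjective
    ⟨((ContinuousLinearMap.compL ℂ (predual (A := A)) (StrongDual ℂ A) ℂ).flip
      (predual (A := A)).subtypeL ∘L NormedSpace.inclusionInDoubleDual ℂ A).toLinearMap,
      norm_eval⟩ eval_surjective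

theorem equivDual_apply (a : A) (φ : predual (A := A)) : equivDual A a φ = φ.1 a := rfl

/-- The weak-* topology `σ(A, A_*)`. -/
abbrev weakStar : TopologicalSpace A :=
  TopologicalSpace.induced (fun a (φ : predual (A := A)) => φ.1 a) Pi.topologicalSpace

variable {A}

/-- Weak-* continuity of a scalar function on `A`. -/
def WeakStarContinuous (f : A → ℂ) : Prop := @Continuous A ℂ (weakStar A) _ f

theorem weakStarContinuous_of_mem {φ : StrongDual ℂ A} (hφ : φ ∈ predual (A := A)) :
    WeakStarContinuous φ := by
  let _ := weakStar A
  exact continuous_pi_iff.1 (continuous_induced_dom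
    (f := fun (a : A) (φ : predual (A := A)) => φ.1 a)) ⟨φ, hφ⟩

theorem WeakStarContinuous.comp_of_mem {f : A → ℂ} (hf : WeakStarContinuous f) {T : A →L[ℂ] A}
    (hT : ∀ φ ∈ predual (A := A), φ ∘L T ∈ predual (A := A)) :
    WeakStarContinuous fun a => f (T a) := by
  let _ := weakStar A
  refine Continuous.comp hf (continuous_induced_rng.2 (continuous_pi fun φ => ?_))
  exact weakStarContinuous_of_mem (hT φ.1 φ.2)

variable (A) in
/-- The Banach space `L²_{w*}(A, ℂ)` of bounded, separately weak-* continuous bilinear forms on `A`,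
with the norm of bounded bilinear forms. -/
def weakStarForms : Submodule ℂ (A →L[ℂ] A →L[ℂ] ℂ) where
  carrier := {Φ | (∀ y, WeakStarContinuous fun x => Φ x y) ∧ ∀ x, WeakStarContinuous fun y => Φ x y}
  add_mem' {Φ Ψ} hΦ hΨ := by
    let _ := weakStar A
    exact ⟨fun y => Continuous.add (hΦ.1 y) (hΨ.1 y), fun x => Continuous.add (hΦ.2 x) (hΨ.2 x)⟩
  zero_mem' := by
    let _ := weakStar A
    exact ⟨fun y => continuous_const, fun x => continuous_const⟩
  smul_mem' c Φ hΦ := by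
    let _ := weakStar A
    exact ⟨fun y => Continuous.const_smul (hΦ.1 y) c, fun x => Continuous.const_smul (hΦ.2 x) c⟩

/-- The left action `(b · Φ)(x, y) = Φ(x, y b)` on `L²_{w*}(A, ℂ)`. -/
def formLeftAct (b : A) : weakStarForms A →L[ℂ] weakStarForms A :=
  (ContinuousLinearMap.compL ℂ A (A →L[ℂ] ℂ) (A →L[ℂ] ℂ)
    ((ContinuousLinearMap.compL ℂ A A ℂ).flip ((ContinuousLinearMap.mul ℂ A).flip b)) ∘L
      (weakStarForms A).subtypeL).codRestrict (weakStarForms A) fun Φ =>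
    ⟨fun y => Φ.2.1 (y * b), fun x => (Φ.2.2 x).comp_of_mem
      (T := (ContinuousLinearMap.mul ℂ A).flip b) fun φ hφ => comp_mulRight_mem φ hφ b⟩

/-- The right action `(Φ · a)(x, y) = Φ(a x, y)` on `L²_{w*}(A, ℂ)`. -/
def formRightAct (a : A) : weakStarForms A →L[ℂ] weakStarForms A :=
  ((ContinuousLinearMap.compL ℂ A A (A →L[ℂ] ℂ)).flip (ContinuousLinearMap.mul ℂ A a) ∘L
      (weakStarForms A).subtypeL).codRestrict (weakStarForms A) fun Φ =>
    ⟨fun y => (Φ.2.1 y).comp_of_mem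
      (T := ContinuousLinearMap.mul ℂ A a) fun φ hφ => comp_mulLeft_mem φ hφ a,
      fun x => Φ.2.2 (a * x)⟩

theorem formLeftAct_apply (b : A) (Φ : weakStarForms A) (x y : A) :
    (formLeftAct b Φ).1 x y = Φ.1 x (y * b) := rfl

theorem formRightAct_apply (a : A) (Φ : weakStarForms A) (x y : A) :
    (formRightAct a Φ).1 x y = Φ.1 (a * x) y := rfl

/-- The left action `⟨Φ, a · M⟩ = ⟨Φ · a, M⟩` on the dual of `L²_{w*}(A, ℂ)`. -/
def leftAct (a : A) (M : StrongDual ℂ (weakStarForms A)) : StrongDual ℂ (weakStarForms A) :=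
  M ∘L formRightAct a

/-- The right action `⟨Φ, M · a⟩ = ⟨a · Φ, M⟩` on the dual of `L²_{w*}(A, ℂ)`. -/
def rightAct (M : StrongDual ℂ (weakStarForms A)) (a : A) : StrongDual ℂ (weakStarForms A) :=
  M ∘L formLeftAct a

variable (A) in
/-- The restriction to `A_*` of the adjoint of the diagonal operator `x ⊗ y ↦ x y`: it maps
`φ` to the bilinear form `(x, y) ↦ φ (x y)`. -/
def diagAdjoint : predual (A := A) →L[ℂ] weakStarForms A :=
  ((ContinuousLinearMap.compL ℂ A (A →L[ℂ] A) (A →L[ℂ] ℂ)).flip (ContinuousLinearMap.mul ℂ A) ∘L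
    ContinuousLinearMap.compL ℂ A A ℂ ∘L
      (predual (A := A)).subtypeL).codRestrict (weakStarForms A) fun φ =>
    ⟨fun y => weakStarContinuous_of_mem (comp_mulRight_mem φ.1 φ.2 y),
      fun x => weakStarContinuous_of_mem (comp_mulLeft_mem φ.1 φ.2 x)⟩

theorem diagAdjoint_apply (φ : predual (A := A)) (x y : A) :
    (diagAdjoint A φ).1 x y = φ.1 (x * y) := rfl

/-- The extension `Δ_{w*} : L²_{w*}(A, ℂ)^* → (A_*)^* = A` of the diagonal operator. -/
def diag (M : StrongDual ℂ (weakStarForms A)) : A :=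
  (equivDual A).symm (M ∘L diagAdjoint A)

/-- Normal, virtual diagonals: `a · M = M · a` and `a (Δ_{w*} M) = a` for all `a`. -/
def IsNormalVirtualDiagonal (M : StrongDual ℂ (weakStarForms A)) : Prop :=
  ∀ a : A, leftAct a M = rightAct M a ∧ a * diag M = a

end DualBanachAlgebra

end DualBanachAlgebras

section Convolution

variable {X Y : Type*} [TopologicalSpace X] [CompactSpace X] [TopologicalSpace Y] [CompactSpace Y]

/-- `x ↦ ψ (F (x, ·))`. -/
def sliceApply (ψ : StrongDual ℂ C(Y, ℂ)) (F : C(X × Y, ℂ)) : C(X, ℂ) :=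
  ⟨fun x => ψ (F.curry x), ψ.continuous.comp F.curry.continuous⟩

theorem norm_sliceApply_le (ψ : StrongDual ℂ C(Y, ℂ)) (F : C(X × Y, ℂ)) :
    ‖sliceApply ψ F‖ ≤ ‖ψ‖ * ‖F‖ := by
  refine (ContinuousMap.norm_le _ (by positivity)).2 fun x => (ψ.le_opNorm _).trans ?_
  gcongr
  exact (ContinuousMap.norm_le _ (norm_nonneg _)).2 fun y => F.norm_coe_le_norm (x, y)

theorem sliceApply_swap [T2Space X] (φ : StrongDual ℂ C(X, ℂ)) (ψ : StrongDual ℂ C(Y, ℂ))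
    (F : C(X × Y, ℂ)) :
    φ (sliceApply ψ F) = ψ (sliceApply φ (F.comp ContinuousMap.prodSwap)) := by
  let _ : MeasurableSpace X := borel X
  have : BorelSpace X := ⟨rfl⟩
  obtain ⟨m, h, hfin, hreg, hh, hφ⟩ := exists_density φ
  have hint : Integrable (fun x => h x • F.curry x) m := by
    have hb : ∀ x, ‖F.curry x‖ ≤ ‖F‖ := fun x =>
      (ContinuousMap.norm_le _ (norm_nonneg _)).2 fun y => F.norm_coe_le_norm (x, y)
    have hF : Integrable (fun x => F.curry x) m :=
      F.curry.continuous.integrable_of_hasCompactSupport (HasCompactSupport.of_compactSpace _)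
    exact hh.smul_bdd ‖F‖ hF.aestronglyMeasurable (Eventually.of_forall hb)
  have h1 : sliceApply φ (F.comp ContinuousMap.prodSwap) = ∫ x, h x • F.curry x ∂m := by
    ext y
    have := (ContinuousMap.evalCLM ℂ y).integral_comp_comm hint
    simp only [ContinuousMap.evalCLM_apply] at this
    rw [← this]
    change φ _ = _
    rw [hφ]
    refine integral_congr_ae (Eventually.of_forall fun x => ?_)
    exact mul_comm _ _
  rw [h1, ← ψ.integral_comp_comm hint, hφ]
  refine integral_congr_ae (Eventually.of_forall fun x => ?_)
  simp [sliceApply, mul_comm]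

variable {G : Type*} [Group G] [TopologicalSpace G] [IsTopologicalGroup G] [CompactSpace G]

/-- The function `(x, y) ↦ f (x y)`. -/
def mulPullback (f : C(G, ℂ)) : C(G × G, ℂ) := f.comp ⟨fun p => p.1 * p.2, continuous_mul⟩

theorem norm_mulPullback_le (f : C(G, ℂ)) : ‖mulPullback f‖ ≤ ‖f‖ :=
  (ContinuousMap.norm_le _ (norm_nonneg _)).2 fun _ => f.norm_coe_le_norm _

/-- Convolution of functionals: `(φ * ψ)(f) = φ (x ↦ ψ (y ↦ f (x y)))`. -/
def convDual (φ ψ : StrongDual ℂ C(G, ℂ)) : StrongDual ℂ C(G, ℂ) :=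
  LinearMap.mkContinuous
    { toFun := fun f => φ (sliceApply ψ (mulPullback f))
      map_add' := fun f g => by
        rw [← map_add]; congr 1; ext x
        exact map_add ψ ((mulPullback f).curry x) ((mulPullback g).curry x)
      map_smul' := fun c f => by
        rw [RingHom.id_apply, ← map_smul]; congr 1; ext x
        exact map_smul ψ c ((mulPullback f).curry x) } (‖φ‖ * ‖ψ‖) fun f => by
    refine (φ.le_opNorm _).trans ?_
    rw [mul_assoc]
    gcongr
    refine (norm_sliceApply_le _ _).trans ?_
    gcongr
    exact norm_mulPullback_le f

theorem convDual_apply (φ ψ : StrongDual ℂ C(G, ℂ)) (f : C(G, ℂ)) :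
    convDual φ ψ f = φ (sliceApply ψ (mulPullback f)) := rfl

theorem norm_convDual_le (φ ψ : StrongDual ℂ C(G, ℂ)) : ‖convDual φ ψ‖ ≤ ‖φ‖ * ‖ψ‖ :=
  LinearMap.mkContinuous_norm_le _ (by positivity) _

theorem convDual_assoc (φ ψ χ : StrongDual ℂ C(G, ℂ)) :
    convDual (convDual φ ψ) χ = convDual φ (convDual ψ χ) := by
  ext f
  simp only [convDual_apply]
  congr 1
  ext x
  change ψ _ = ψ _
  congr 1
  ext y
  change χ _ = χ _
  congr 1
  ext z
  change f (x * y * z) = f (x * (y * z))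
  rw [mul_assoc]

end Convolution

namespace MeasureAlgebra

variable {G : Type*} [Group G] [TopologicalSpace G] [IsTopologicalGroup G] [CompactSpace G]
  [T2Space G] [MeasurableSpace G] [BorelSpace G]

/-- Convolution: `μ * ν` is the regular complex Borel measure with
`∫ f d(μ * ν) = ∫ ∫ f (x y) dν(y) dμ(x)` for all `f ∈ C(G)`. -/
instance : Mul (MeasureAlgebra G) :=
  ⟨fun μ ν => (riesz G).symm (convDual (riesz G μ) (riesz G ν))⟩

theorem riesz_mul (μ ν : MeasureAlgebra G) :
    riesz G (μ * ν) = convDual (riesz G μ) (riesz G ν) :=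
  (riesz G).apply_symm_apply _

theorem cintegral_mul (μ ν : MeasureAlgebra G) (f : C(G, ℂ)) :
    cintegral (μ * ν).toMeasure f =
      cintegral μ.toMeasure fun x => cintegral ν.toMeasure fun y => f (x * y) :=
  congrArg (fun φ : StrongDual ℂ C(G, ℂ) => φ f) (riesz_mul μ ν)

theorem cintegral_mul' (μ ν : MeasureAlgebra G) (f : C(G, ℂ)) :
    cintegral (μ * ν).toMeasure f =
      cintegral ν.toMeasure fun y => cintegral μ.toMeasure fun x => f (x * y) :=
  (cintegral_mul μ ν f).trans (sliceApply_swap (riesz G μ) (riesz G ν) (mulPullback f))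

instance : NonUnitalNormedRing (MeasureAlgebra G) where
  __ := (inferInstance : NormedAddCommGroup (MeasureAlgebra G))
  mul := (· * ·)
  left_distrib μ ν ρ := (riesz G).injective <| by
    rw [map_add]
    simp only [riesz_mul]
    ext f
    change riesz G μ _ = riesz G μ _ + riesz G μ _
    rw [← map_add, map_add]
    rfl
  right_distrib μ ν ρ := (riesz G).injective <| by
    rw [map_add]
    simp only [riesz_mul, map_add]
    rfl
  zero_mul μ := (riesz G).injective <| by
    simp only [riesz_mul, map_zero]
    rfl
  mul_zero μ := (riesz G).injective <| by
    simp only [riesz_mul, map_zero]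
    ext f
    exact map_zero (riesz G μ)
  mul_assoc μ ν ρ := (riesz G).injective <| by
    simp only [riesz_mul, convDual_assoc]
  norm_mul_le μ ν := by
    rw [← (riesz G).norm_map, riesz_mul, ← (riesz G).norm_map μ, ← (riesz G).norm_map ν]
    exact norm_convDual_le _ _

instance : IsScalarTower ℂ (MeasureAlgebra G) (MeasureAlgebra G) where
  smul_assoc c μ ν := (riesz G).injective <| by
    simp only [smul_eq_mul, riesz_mul, map_smul]
    rfl

instance : SMulCommClass ℂ (MeasureAlgebra G) (MeasureAlgebra G) where
  smul_comm c μ ν := (riesz G).injective <| by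
    simp only [smul_eq_mul, riesz_mul, map_smul]
    ext f
    change c • (riesz G μ) _ = (riesz G μ) _
    rw [← map_smul]
    rfl

variable (G) in
/-- The canonical isometric embedding of `C(G)` into `M(G)^*`. -/
def ofContinuous : C(G, ℂ) →ₗᵢ[ℂ] StrongDual ℂ (MeasureAlgebra G) where
  toLinearMap := (((ContinuousLinearMap.compL ℂ (MeasureAlgebra G) (StrongDual ℂ C(G, ℂ)) ℂ).flip
    (riesz G).toContinuousLinearEquiv.toContinuousLinearMap) ∘L
      NormedSpace.inclusionInDoubleDual ℂ C(G, ℂ)).toLinearMap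
  norm_map' f := by
    refine (ContinuousLinearMap.opNorm_comp_linearIsometryEquiv
      (NormedSpace.inclusionInDoubleDual ℂ C(G, ℂ) f) (riesz G)).trans ?_
    exact (NormedSpace.inclusionInDoubleDualLi ℂ (E := C(G, ℂ))).norm_map f

theorem ofContinuous_apply (f : C(G, ℂ)) (μ : MeasureAlgebra G) :
    ofContinuous G f μ = cintegral μ.toMeasure f := rfl

/-- `M(G)` is a dual Banach algebra with predual `C(G)`. -/
instance : DualBanachAlgebra (MeasureAlgebra G) where
  predual := (ofContinuous G).toLinearMap.range
  isClosed_predual := by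
    rw [LinearMap.coe_range]
    exact (ofContinuous G).isometry.isClosedEmbedding.isClosed_range
  comp_mulLeft_mem := by
    rintro _ ⟨f, rfl⟩ μ
    refine ⟨sliceApply (riesz G μ) ((mulPullback f).comp ContinuousMap.prodSwap),
      ContinuousLinearMap.ext fun ν => (cintegral_mul' μ ν f).symm⟩
  comp_mulRight_mem := by
    rintro _ ⟨f, rfl⟩ ν
    exact ⟨sliceApply (riesz G ν) (mulPullback f),
      ContinuousLinearMap.ext fun μ => (cintegral_mul μ ν f).symm⟩
  norm_eval μ := by
    refine le_antisymm ?_ ?_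
    · refine ContinuousLinearMap.opNorm_le_bound _ (norm_nonneg _) fun φ => ?_
      rw [mul_comm]
      exact φ.1.le_opNorm μ
    · rw [← (riesz G).norm_map μ]
      refine ContinuousLinearMap.opNorm_le_bound _ (ContinuousLinearMap.opNorm_nonneg _) fun f => ?_
      have h := ContinuousLinearMap.le_opNorm
        ((NormedSpace.inclusionInDoubleDual ℂ (MeasureAlgebra G) μ) ∘L
          (ofContinuous G).toLinearMap.range.subtypeL) ⟨ofContinuous G f, f, rfl⟩
      refine h.trans (le_of_eq ?_)
      congr 1
      exact (ofContinuous G).norm_map f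
  eval_surjective ψ := by
    let J : C(G, ℂ) →L[ℂ] (ofContinuous G).toLinearMap.range :=
      (ofContinuous G).toContinuousLinearMap.codRestrict _ fun f => ⟨f, rfl⟩
    refine ⟨(riesz G).symm (ψ ∘L J), ContinuousLinearMap.ext ?_⟩
    rintro ⟨_, f, rfl⟩
    change riesz G ((riesz G).symm (ψ ∘L J)) f = _
    rw [LinearIsometryEquiv.apply_symm_apply]
    rfl

end MeasureAlgebra

end

/-! For a finite group, the average of `δ_g ⊗ δ_{g⁻¹}` over `g` is a diagonal. On a compact group
the analogue would be `Φ ↦ ∫ Φ(δ_g, δ_{g⁻¹}) dm(g)` with `m` the Haar probability measure. But `(g,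
h) ↦ Φ(δ_g, δ_h)` is only separately continuous, so its restriction to an antidiagonal need not be
tractable, and Fubini is in doubt.

The remedy is to smooth the first factor. For a continuous density `φ`, the measure `δ_g * φ m`
depends norm continuously on `g`, so `(g, h) ↦ Φ(δ_g * φ m, δ_h)` is jointly continuous
(`formKernel`). Then `averagedDiagonal m φ`, that is `Φ ↦ ∫ Φ(δ_g * φ m, δ_{g⁻¹}) dm(g)`, is well
defined with norm at most `∫ |φ| dm`. It commutes exactly with every `a`
(`leftAct_averagedDiagonal`): weak-* continuity replaces `a` by its point masses, Fubini swaps the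
integrals, and the substitution `g ↦ x g` is free by left invariance.

The price of smoothing is that the diagonal operator now yields the average of the conjugates of `φ
m` instead of `δ_1`. When `φ ≥ 0` has integral one and its support shrinks to the identity, these
averages tend weak-* to `δ_1`, because `f (g x g⁻¹) → f 1` uniformly in `g` as `x → 1`
(`eventually_norm_conjPullback_sub_le`). A weak-* limit of the `averagedDiagonal m φ` along an
ultrafilter is the required `M`. -/

noncomputable section

/-! ### Weak-* limits and integrability of continuous functions -/

/-- Bounded families of functionals converge pointwise along ultrafilters. -/
theorem Ultrafilter.exists_strongDual_tendsto {ι E : Type*} [SeminormedAddCommGroup E]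
    [NormedSpace ℂ E] (u : Ultrafilter ι) (D : ι → StrongDual ℂ E) {r : ℝ} (hD : ∀ i, ‖D i‖ ≤ r) :
    ∃ M : StrongDual ℂ E, ∀ x, Tendsto (fun i => D i x) u (𝓝 (M x)) := by
  let D' : ι → WeakDual ℂ E := fun i => StrongDual.toWeakDual (D i)
  have hball : ∀ i, D' i ∈ WeakDual.toStrongDual ⁻¹' Metric.closedBall (0 : StrongDual ℂ E) r :=
    fun i => by simpa [D'] using hD i
  -- Banach–Alaoglu: the image ultrafilter lives on a weak-* compact ball, so it converges.
  obtain ⟨M, -, hM⟩ := (WeakDual.isCompact_closedBall (0 : StrongDual ℂ E) r).ultrafilter_le_nhds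
    (u.map D') (tendsto_principal.2 (Eventually.of_forall hball))
  exact ⟨WeakDual.toStrongDual M, fun x =>
    ((WeakDual.eval_continuous x).tendsto M).comp (show Tendsto D' u (𝓝 M) from hM)⟩

theorem ContinuousMap.integrable_of_isFiniteMeasure {X : Type*} [TopologicalSpace X]
    [CompactSpace X] [MeasurableSpace X] [BorelSpace X] (m : Measure X) [IsFiniteMeasure m]
    (f : C(X, ℂ)) : Integrable f m :=
  f.continuous.integrable_of_hasCompactSupport (HasCompactSupport.of_compactSpace _)

/-! ### Functionals given by continuous densities -/

section DensityDual

variable {X : Type*} [TopologicalSpace X] [CompactSpace X] [MeasurableSpace X] [BorelSpace X]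
  (m : Measure X) [IsFiniteMeasure m]

/-- The functional `f ↦ ∫ f φ dm` on `C(X)`. -/
def densityDual (φ : C(X, ℂ)) : StrongDual ℂ C(X, ℂ) :=
  LinearMap.mkContinuous
    { toFun := fun f => ∫ x, f x * φ x ∂m
      map_add' := fun f g => by
        simp only [ContinuousMap.add_apply, add_mul]
        exact integral_add ((f * φ).integrable_of_isFiniteMeasure m)
          ((g * φ).integrable_of_isFiniteMeasure m)
      map_smul' := fun c f => by
        rw [RingHom.id_apply, smul_eq_mul, ← integral_const_mul]
        simp [mul_assoc] } (∫ x, ‖φ x‖ ∂m) fun f => by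
    refine (norm_integral_le_integral_norm _).trans ?_
    rw [mul_comm, ← integral_const_mul]
    refine integral_mono ((f * φ).integrable_of_isFiniteMeasure m).norm
      ((φ.integrable_of_isFiniteMeasure m).norm.const_mul _) fun x => ?_
    simp only [norm_mul]
    gcongr
    exact f.norm_coe_le_norm x

theorem densityDual_apply (φ f : C(X, ℂ)) : densityDual m φ f = ∫ x, f x * φ x ∂m := rfl

theorem norm_densityDual_le (φ : C(X, ℂ)) : ‖densityDual m φ‖ ≤ ∫ x, ‖φ x‖ ∂m :=
  LinearMap.mkContinuous_norm_le _ (by positivity) _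

theorem densityDual_sub (φ ψ : C(X, ℂ)) :
    densityDual m φ - densityDual m ψ = densityDual m (φ - ψ) := by
  ext f
  simp only [sub_apply, densityDual_apply, ContinuousMap.sub_apply, mul_sub]
  exact (integral_sub ((f * φ).integrable_of_isFiniteMeasure m)
    ((f * ψ).integrable_of_isFiniteMeasure m)).symm

theorem continuous_densityDual : Continuous (densityDual m) := by
  refine LipschitzWith.continuous (K := (m.real univ).toNNReal) <|
    LipschitzWith.of_dist_le_mul fun φ ψ => ?_
  rw [dist_eq_norm, dist_eq_norm, densityDual_sub, Real.coe_toNNReal _ measureReal_nonneg]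
  refine (norm_densityDual_le m _).trans ?_
  have h := integral_mono ((φ - ψ).integrable_of_isFiniteMeasure m).norm
    (integrable_const ‖φ - ψ‖) fun x => (φ - ψ).norm_coe_le_norm x
  simpa using h

/-- Fubini for a measure against a functional. Integration against `m` is the functional
`densityDual m 1`, so `sliceApply_swap` applies and no product measure is involved. -/
theorem integral_sliceApply [T2Space X] {Y : Type*} [TopologicalSpace Y] [CompactSpace Y]
    [T2Space Y] (ψ : StrongDual ℂ C(Y, ℂ)) (F : C(X × Y, ℂ)) :
    ∫ x, sliceApply ψ F x ∂m =
      ψ (sliceApply (densityDual m 1) (F.comp ContinuousMap.prodSwap)) := by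
  rw [← sliceApply_swap, densityDual_apply]
  simp

end DensityDual

namespace MeasureAlgebra

open DualBanachAlgebra

/-! ### Point masses and absolutely continuous measures -/

section Dirac

variable {X : Type*} [TopologicalSpace X] [CompactSpace X] [T2Space X]
  [MeasurableSpace X] [BorelSpace X]

/-- The point mass at `x`. -/
def dirac (x : X) : MeasureAlgebra X := (riesz X).symm (ContinuousMap.evalCLM ℂ x)

theorem riesz_dirac (x : X) (f : C(X, ℂ)) : riesz X (dirac x) f = f x := by
  rw [dirac, LinearIsometryEquiv.apply_symm_apply]; rfl

theorem norm_dirac_le (x : X) : ‖dirac x‖ ≤ 1 := by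
  rw [← (riesz X).norm_map]
  refine ContinuousLinearMap.opNorm_le_bound _ zero_le_one fun f => ?_
  rw [riesz_dirac, one_mul]
  exact f.norm_coe_le_norm x

/-- The measure with continuous density `φ` with respect to `m`. -/
def ofDensity (m : Measure X) [IsFiniteMeasure m] (φ : C(X, ℂ)) : MeasureAlgebra X :=
  (riesz X).symm (densityDual m φ)

theorem riesz_ofDensity (m : Measure X) [IsFiniteMeasure m] (φ : C(X, ℂ)) :
    riesz X (ofDensity m φ) = densityDual m φ :=
  (riesz X).apply_symm_apply _

theorem norm_ofDensity_le (m : Measure X) [IsFiniteMeasure m] (φ : C(X, ℂ)) :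
    ‖ofDensity m φ‖ ≤ ∫ x, ‖φ x‖ ∂m := by
  rw [← (riesz X).norm_map, riesz_ofDensity]
  exact norm_densityDual_le m φ

end Dirac

variable {G : Type*} [Group G] [TopologicalSpace G] [IsTopologicalGroup G] [CompactSpace G]

/-- The function `(x, g) ↦ f (g x g⁻¹)`. -/
def conjPullback (f : C(G, ℂ)) : C(G × G, ℂ) :=
  f.comp ⟨fun p => p.2 * p.1 * p.2⁻¹, by fun_prop⟩

/-- Uniformity in `g` comes from compactness: currying makes `x ↦ (g ↦ f (g x g⁻¹))` continuous for
the sup norm, and at `x = 1` this function of `g` is the constant `f 1`. -/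
theorem eventually_norm_conjPullback_sub_le (f : C(G, ℂ)) {ε : ℝ} (hε : 0 < ε) :
    ∀ᶠ x in 𝓝 (1 : G), ∀ g, ‖conjPullback f (x, g) - f 1‖ ≤ ε := by
  have h := (conjPullback f).curry.continuous.tendsto 1
  filter_upwards [h (Metric.closedBall_mem_nhds _ hε)] with x hx g
  have h1 := ContinuousMap.norm_coe_le_norm
    ((conjPullback f).curry x - (conjPullback f).curry 1) g
  rw [mem_preimage, Metric.mem_closedBall, dist_eq_norm] at hx
  have h2 : conjPullback f (1, g) = f 1 := by simp [conjPullback]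
  rw [← h2]
  exact h1.trans hx

variable [T2Space G] [MeasurableSpace G] [BorelSpace G]

/-! ### Products with point masses and weak-* continuous functionals -/

theorem dirac_mul_dirac (g h : G) : dirac g * dirac h = dirac (g * h) := by
  refine (riesz G).injective (ContinuousLinearMap.ext fun f => ?_)
  rw [riesz_mul, convDual_apply, riesz_dirac, riesz_dirac]
  exact riesz_dirac h _

theorem mul_dirac_one (μ : MeasureAlgebra G) : μ * dirac 1 = μ := by
  refine (riesz G).injective (ContinuousLinearMap.ext fun f => ?_)
  rw [riesz_mul, convDual_apply]
  congr 1
  ext x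
  refine (riesz_dirac 1 _).trans ?_
  change f (x * 1) = f x
  rw [mul_one]

/-- A linear functional continuous for the initial topology of a family of functionals lies in their
linear span. Here the family is already a subspace, the image of `C(G)`, so the span adds nothing.
-/
theorem exists_riesz_of_weakStarContinuous {ψ : StrongDual ℂ (MeasureAlgebra G)}
    (hψ : WeakStarContinuous ψ) : ∃ f : C(G, ℂ), ∀ μ, ψ μ = riesz G μ f := by
  have h : ψ.toLinearMap ∈ Submodule.span ℂ (range fun φ : predual (A := MeasureAlgebra G) =>
      φ.1.toLinearMap) := by
    rw [LinearMap.mem_span_iff_continuous]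
    have e : weakStar (MeasureAlgebra G) = ⨅ φ : predual (A := MeasureAlgebra G),
        TopologicalSpace.induced φ.1.toLinearMap inferInstance := induced_to_pi _
    rw [← e]
    exact hψ
  have hle : Submodule.span ℂ (range fun φ : predual (A := MeasureAlgebra G) =>
      φ.1.toLinearMap) ≤ (predual (A := MeasureAlgebra G)).map
        (ContinuousLinearMap.coeLM ℂ) :=
    Submodule.span_le.2 (range_subset_iff.2 fun φ => ⟨φ.1, φ.2, rfl⟩)
  obtain ⟨_, ⟨f, rfl⟩, hf⟩ := hle h
  exact ⟨f, fun μ => (LinearMap.congr_fun hf μ).symm⟩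

theorem continuous_apply_dirac {ψ : StrongDual ℂ (MeasureAlgebra G)}
    (hψ : WeakStarContinuous ψ) : Continuous fun g => ψ (dirac g) := by
  obtain ⟨f, hf⟩ := exists_riesz_of_weakStarContinuous hψ
  simp only [hf, riesz_dirac]
  exact f.continuous

/-- A weak-* continuous functional is integration of its values at point masses. -/
theorem apply_eq_riesz {ψ : StrongDual ℂ (MeasureAlgebra G)} (hψ : WeakStarContinuous ψ)
    (F : C(G, ℂ)) (hF : ∀ g, F g = ψ (dirac g)) (μ : MeasureAlgebra G) :
    ψ μ = riesz G μ F := by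
  obtain ⟨f, hf⟩ := exists_riesz_of_weakStarContinuous hψ
  rw [hf]
  congr 1
  ext g
  rw [hF, hf, riesz_dirac]

/-! ### Smoothing by Haar densities -/

section Haar

variable (m : Measure G) [IsFiniteMeasure m]

/-- The function `(g, x) ↦ φ (g⁻¹ x)`. -/
def translates (φ : C(G, ℂ)) : C(G × G, ℂ) := φ.comp ⟨fun p => p.1⁻¹ * p.2, by fun_prop⟩

/-- A Urysohn function, equal to 1 at the identity and 0 off the interior of `U`, is divided by its
integral, which is positive because `m` charges open sets. Nonnegativity makes both integrals equal
to one. -/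
theorem exists_density_supported [m.IsOpenPosMeasure] {U : Set G} (hU : U ∈ 𝓝 1) :
    ∃ φ : C(G, ℂ), ∫ x, φ x ∂m = 1 ∧ ∫ x, ‖φ x‖ ∂m = 1 ∧ ∀ x, φ x ≠ 0 → x ∈ U := by
  obtain ⟨ψ, h0, h1, h01⟩ := exists_continuous_zero_one_of_isClosed
    (isOpen_interior (s := U)).isClosed_compl (isClosed_singleton (x := (1 : G)))
    (by simpa using mem_interior_iff_mem_nhds.2 hU)
  have hpos : 0 < ∫ x, ψ x ∂m :=
    ψ.continuous.integral_pos_of_hasCompactSupport_nonneg_nonzero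
      (HasCompactSupport.of_compactSpace _) (fun x => (h01 x).1) (x := 1)
      (by rw [h1 rfl]; exact one_ne_zero)
  set c := ∫ x, ψ x ∂m with hc
  refine ⟨⟨fun x => ((c⁻¹ * ψ x : ℝ) : ℂ), by fun_prop⟩, ?_, ?_, fun x hx => ?_⟩
  · change ∫ x, ((c⁻¹ * ψ x : ℝ) : ℂ) ∂m = 1
    rw [integral_complex_ofReal, integral_const_mul, ← hc, inv_mul_cancel₀ hpos.ne',
      Complex.ofReal_one]
  · change ∫ x, ‖((c⁻¹ * ψ x : ℝ) : ℂ)‖ ∂m = 1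
    have e : ∀ x, ‖((c⁻¹ * ψ x : ℝ) : ℂ)‖ = c⁻¹ * ψ x := fun x => by
      rw [Complex.norm_real, Real.norm_of_nonneg]
      have := (h01 x).1
      positivity
    simp only [e]
    rw [integral_const_mul, ← hc, inv_mul_cancel₀ hpos.ne']
  · by_contra hxU
    refine hx ?_
    have : ψ x = 0 := h0 fun hx' => hxU (interior_subset hx')
    change ((c⁻¹ * ψ x : ℝ) : ℂ) = 0
    simp [this]

variable [m.IsMulLeftInvariant]

theorem dirac_mul_ofDensity (φ : C(G, ℂ)) (g : G) :
    dirac g * ofDensity m φ = ofDensity m ((translates φ).curry g) := by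
  refine (riesz G).injective (ContinuousLinearMap.ext fun f => ?_)
  rw [riesz_mul, convDual_apply, riesz_dirac, riesz_ofDensity, riesz_ofDensity, densityDual_apply]
  change ∫ x, f (g * x) * φ x ∂m = _
  rw [← integral_mul_left_eq_self _ g⁻¹]
  simp [translates]

/-- This is the gain from smoothing: the translates of a continuous density vary continuously in sup
norm, hence the measures vary continuously in total variation, whereas `g ↦ dirac g` is in general
only weak-* continuous. -/
theorem continuous_dirac_mul_ofDensity (φ : C(G, ℂ)) :
    Continuous fun g => dirac g * ofDensity m φ := by
  simp only [dirac_mul_ofDensity]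
  exact (riesz G).symm.continuous.comp ((continuous_densityDual m).comp
    (translates φ).curry.continuous)

/-- The function `(g, h) ↦ Φ(δ_g * φ m, δ_h)`, which is jointly continuous since the translates of
`φ m` depend norm continuously on `g`. -/
def formKernel (φ : C(G, ℂ)) (Φ : weakStarForms (MeasureAlgebra G)) : C(G × G, ℂ) where
  toFun p := Φ.1 (dirac p.1 * ofDensity m φ) (dirac p.2)
  continuous_toFun := by
    -- Continuity in the group variable for fixed `μ`, together with a Lipschitz bound in `μ` that
    -- is uniform over point masses, gives joint continuity.
    have h : Continuous fun q : MeasureAlgebra G × G => Φ.1 q.1 (dirac q.2) := by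
      refine continuous_prod_of_continuous_lipschitzWith _ ‖Φ.1‖₊
        (fun μ => continuous_apply_dirac (Φ.2.2 μ)) fun k => ?_
      refine LipschitzWith.of_dist_le_mul fun μ ν => ?_
      rw [dist_eq_norm, dist_eq_norm, ← sub_apply, ← map_sub]
      refine (Φ.1.le_opNorm₂ _ _).trans ?_
      exact mul_le_of_le_one_right (by positivity) (norm_dirac_le k)
    exact h.comp (((continuous_dirac_mul_ofDensity m φ).comp continuous_fst).prodMk continuous_snd)

/-- The function `g ↦ Φ(δ_g * φ m, δ_{g⁻¹})`. -/
def antidiagonal (φ : C(G, ℂ)) (Φ : weakStarForms (MeasureAlgebra G)) : C(G, ℂ) :=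
  (formKernel m φ Φ).comp ⟨fun g => (g, g⁻¹), by fun_prop⟩

theorem antidiagonal_apply (φ : C(G, ℂ)) (Φ : weakStarForms (MeasureAlgebra G)) (g : G) :
    antidiagonal m φ Φ g = Φ.1 (dirac g * ofDensity m φ) (dirac g⁻¹) := rfl

theorem norm_antidiagonal_le (φ : C(G, ℂ)) (Φ : weakStarForms (MeasureAlgebra G)) (g : G) :
    ‖antidiagonal m φ Φ g‖ ≤ (∫ x, ‖φ x‖ ∂m) * ‖Φ‖ := by
  rw [antidiagonal_apply]
  refine (Φ.1.le_opNorm₂ _ _).trans ?_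
  have h : ‖dirac g * ofDensity m φ‖ ≤ ∫ x, ‖φ x‖ ∂m :=
    (norm_mul_le _ _).trans ((mul_le_of_le_one_left (norm_nonneg _) (norm_dirac_le g)).trans
      (norm_ofDensity_le m φ))
  refine (mul_le_of_le_one_right (by positivity) (norm_dirac_le _)).trans ?_
  rw [mul_comm]
  exact mul_le_mul_of_nonneg_right h (norm_nonneg Φ.1)

/-- Weak-* continuity in the first variable lets `a` be replaced by an integral of point masses
`dirac x`; then `dirac x * dirac g` shifts the first argument of the kernel. In the lambda, `p = (g,
x)`. -/
theorem antidiagonal_formRightAct (φ : C(G, ℂ)) (a : MeasureAlgebra G)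
    (Φ : weakStarForms (MeasureAlgebra G)) :
    antidiagonal m φ (formRightAct a Φ) = sliceApply (riesz G a)
      ((formKernel m φ Φ).comp ⟨fun p : G × G => (p.2 * p.1, p.1⁻¹), by fun_prop⟩) := by
  ext g
  rw [antidiagonal_apply, formRightAct_apply]
  -- Right multiplication by a fixed measure preserves the predual, so composing with it keeps
  -- weak-* continuity.
  let T := (ContinuousLinearMap.mul ℂ (MeasureAlgebra G)).flip (dirac g * ofDensity m φ)
  have hψ : WeakStarContinuous (Φ.1.flip (dirac g⁻¹) ∘L T) :=
    (Φ.2.1 (dirac g⁻¹)).comp_of_mem (T := T) fun φ hφ => comp_mulRight_mem φ hφ _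
  refine apply_eq_riesz hψ _ (fun x => ?_) a
  change Φ.1 (dirac (x * g) * ofDensity m φ) (dirac g⁻¹) =
    Φ.1 (dirac x * (dirac g * ofDensity m φ)) (dirac g⁻¹)
  rw [← mul_assoc, dirac_mul_dirac]

/-- Mirror image of `antidiagonal_formRightAct`: here the second variable absorbs `a`, through
`dirac g⁻¹ * dirac x`. -/
theorem antidiagonal_formLeftAct (φ : C(G, ℂ)) (a : MeasureAlgebra G)
    (Φ : weakStarForms (MeasureAlgebra G)) :
    antidiagonal m φ (formLeftAct a Φ) = sliceApply (riesz G a)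
      ((formKernel m φ Φ).comp ⟨fun p : G × G => (p.1, p.1⁻¹ * p.2), by fun_prop⟩) := by
  ext g
  rw [antidiagonal_apply, formLeftAct_apply]
  let T := ContinuousLinearMap.mul ℂ (MeasureAlgebra G) (dirac g⁻¹)
  have hψ : WeakStarContinuous (Φ.1 (dirac g * ofDensity m φ) ∘L T) :=
    (Φ.2.2 _).comp_of_mem (T := T) fun φ hφ => comp_mulLeft_mem φ hφ _
  refine apply_eq_riesz hψ _ (fun x => ?_) a
  change Φ.1 (dirac g * ofDensity m φ) (dirac (g⁻¹ * x)) =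
    Φ.1 (dirac g * ofDensity m φ) (dirac g⁻¹ * dirac x)
  rw [dirac_mul_dirac]

/-! ### Averaged diagonals -/

/-- The functional `Φ ↦ ∫ Φ(δ_g * φ m, δ_{g⁻¹}) dm(g)`. -/
def averagedDiagonal [IsProbabilityMeasure m] (φ : C(G, ℂ)) :
    StrongDual ℂ (weakStarForms (MeasureAlgebra G)) :=
  LinearMap.mkContinuous
    { toFun := fun Φ => ∫ g, antidiagonal m φ Φ g ∂m
      map_add' := fun Φ Ψ => integral_add ((antidiagonal m φ Φ).integrable_of_isFiniteMeasure m)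
        ((antidiagonal m φ Ψ).integrable_of_isFiniteMeasure m)
      map_smul' := fun c Φ => integral_const_mul c (antidiagonal m φ Φ) } (∫ x, ‖φ x‖ ∂m)
    fun Φ => by
      have h := norm_integral_le_of_norm_le_const (μ := m)
        (Eventually.of_forall (norm_antidiagonal_le m φ Φ))
      rw [probReal_univ, mul_one] at h
      exact h

variable [IsProbabilityMeasure m]

theorem averagedDiagonal_apply (φ : C(G, ℂ)) (Φ : weakStarForms (MeasureAlgebra G)) :
    averagedDiagonal m φ Φ = ∫ g, antidiagonal m φ Φ g ∂m := rfl

theorem norm_averagedDiagonal_le (φ : C(G, ℂ)) : ‖averagedDiagonal m φ‖ ≤ ∫ x, ‖φ x‖ ∂m :=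
  LinearMap.mkContinuous_norm_le _ (by positivity) _

/-- After Fubini both sides integrate against `a` a function of `x`, and for each `x` the two Haar
integrals agree by left invariance. -/
theorem leftAct_averagedDiagonal (φ : C(G, ℂ)) (a : MeasureAlgebra G) :
    leftAct a (averagedDiagonal m φ) = rightAct (averagedDiagonal m φ) a := by
  suffices h : ∀ Φ, averagedDiagonal m φ (formRightAct a Φ) =
      averagedDiagonal m φ (formLeftAct a Φ) from ContinuousLinearMap.ext h
  intro Φ
  rw [averagedDiagonal_apply, averagedDiagonal_apply, antidiagonal_formRightAct,
    antidiagonal_formLeftAct, integral_sliceApply, integral_sliceApply]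
  refine congrArg (riesz G a) (ContinuousMap.ext fun x => ?_)
  change densityDual m 1 _ = densityDual m 1 _
  rw [densityDual_apply, densityDual_apply]
  change ∫ g, formKernel m φ Φ (x * g, g⁻¹) * 1 ∂m =
    ∫ g, formKernel m φ Φ (g, g⁻¹ * x) * 1 ∂m
  -- Replacing `g` by `x g` turns `(g, g⁻¹ x)` into `(x g, g⁻¹)`.
  rw [← integral_mul_left_eq_self (fun g => formKernel m φ Φ (g, g⁻¹ * x) * 1) x]
  simp

/-- The product `δ_g * φ m * δ_{g⁻¹}` is the image of `φ m` under conjugation by `g`. -/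
theorem averagedDiagonal_diagAdjoint (φ f : C(G, ℂ)) :
    averagedDiagonal m φ (diagAdjoint (MeasureAlgebra G) ⟨ofContinuous G f, f, rfl⟩) =
      ∫ g, ∫ x, conjPullback f (x, g) * φ x ∂m ∂m := by
  rw [averagedDiagonal_apply]
  congr 1
  ext g
  rw [antidiagonal_apply, diagAdjoint_apply]
  change riesz G _ f = _
  rw [riesz_mul, riesz_mul, convDual_apply, convDual_apply, riesz_dirac, riesz_ofDensity]
  change densityDual m φ _ = _
  rw [densityDual_apply]
  congr 1
  ext x
  congr 1
  exact riesz_dirac g⁻¹ _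

/-- The condition `∫ φ = 1` allows `f 1` to be moved inside the integral, and `∫ ‖φ‖ = 1` keeps the
bound `ε` without loss. -/
theorem norm_averagedDiagonal_diagAdjoint_sub_le {φ f : C(G, ℂ)} {ε : ℝ}
    (hφ : ∫ x, φ x ∂m = 1) (hφ' : ∫ x, ‖φ x‖ ∂m = 1)
    (h : ∀ x, φ x ≠ 0 → ∀ g, ‖conjPullback f (x, g) - f 1‖ ≤ ε) :
    ‖averagedDiagonal m φ (diagAdjoint (MeasureAlgebra G) ⟨ofContinuous G f, f, rfl⟩) - f 1‖
      ≤ ε := by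
  have hin : ∀ g, ‖(∫ x, conjPullback f (x, g) * φ x ∂m) - f 1‖ ≤ ε := fun g => by
    have hc : Integrable (fun x => conjPullback f (x, g) * φ x) m :=
      ContinuousMap.integrable_of_isFiniteMeasure m
        ⟨fun x => conjPullback f (x, g) * φ x, by fun_prop⟩
    have e : (∫ x, conjPullback f (x, g) * φ x ∂m) - f 1 =
        ∫ x, (conjPullback f (x, g) - f 1) * φ x ∂m := by
      simp only [sub_mul]
      rw [integral_sub hc ((φ.integrable_of_isFiniteMeasure m).const_mul _), integral_const_mul,
        hφ, mul_one]
    rw [e]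
    calc _ ≤ ∫ x, ε * ‖φ x‖ ∂m := norm_integral_le_of_norm_le
          ((φ.integrable_of_isFiniteMeasure m).norm.const_mul ε)
          (Eventually.of_forall fun x => by
            rw [norm_mul]
            by_cases hx : φ x = 0
            · simp [hx]
            · exact mul_le_mul_of_nonneg_right (h x hx g) (norm_nonneg _))
      _ = ε := by rw [integral_const_mul, hφ', mul_one]
  rw [averagedDiagonal_diagAdjoint]
  -- The inner integral is a slice of a continuous function, hence continuous in `g`.
  have hF : Integrable (fun g => ∫ x, conjPullback f (x, g) * φ x ∂m) m :=
    (sliceApply (densityDual m φ)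
      ((conjPullback f).comp ContinuousMap.prodSwap)).integrable_of_isFiniteMeasure m
  have e : (∫ g, ∫ x, conjPullback f (x, g) * φ x ∂m ∂m) - f 1 =
      ∫ g, ((∫ x, conjPullback f (x, g) * φ x ∂m) - f 1) ∂m := by
    rw [integral_sub hF (integrable_const _)]
    simp
  rw [e]
  simpa using norm_integral_le_of_norm_le_const (μ := m) (Eventually.of_forall hin)

/-- The predual is the image of `C(G)`, so testing on continuous functions determines the element of
`M(G)`. -/
theorem diag_eq_dirac_one {M : StrongDual ℂ (weakStarForms (MeasureAlgebra G))}
    (hM : ∀ f : C(G, ℂ), M (diagAdjoint (MeasureAlgebra G) ⟨ofContinuous G f, f, rfl⟩) = f 1) :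
    diag M = dirac 1 := by
  refine (equivDual (MeasureAlgebra G)).injective ?_
  rw [diag, LinearIsometryEquiv.apply_symm_apply]
  refine ContinuousLinearMap.ext ?_
  rintro ⟨_, f, rfl⟩
  rw [equivDual_apply]
  exact (hM f).trans (riesz_dirac 1 f).symm

/-! ### Passage to the limit -/

theorem exists_isNormalVirtualDiagonal [m.IsOpenPosMeasure] :
    ∃ M : StrongDual ℂ (weakStarForms (MeasureAlgebra G)), IsNormalVirtualDiagonal M := by
  choose φ hφ hφ' hφU using fun U : {U : Set G // U ∈ 𝓝 1} => exists_density_supported m U.2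
  -- The index `U` shrinks to the identity along `l`; the filter is proper since every neighbourhood
  -- is itself an index.
  let l : Filter {U : Set G // U ∈ 𝓝 1} := comap Subtype.val (𝓝 (1 : G)).smallSets
  have hl : l.NeBot := by
    refine comap_neBot fun t ht => ?_
    obtain ⟨s, hs, hst⟩ := eventually_smallSets.1 ht
    exact ⟨⟨s, hs⟩, hst s Subset.rfl⟩
  let u := Ultrafilter.of l
  obtain ⟨M, hlim⟩ := u.exists_strongDual_tendsto (fun U => averagedDiagonal m (φ U))
    (fun U => (norm_averagedDiagonal_le m (φ U)).trans_eq (hφ' U))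
  refine ⟨M, fun a => ⟨ContinuousLinearMap.ext fun Φ => ?_, ?_⟩⟩
  -- The commutation is exact for every `U`, so both sides are limits of the same family.
  · refine tendsto_nhds_unique (hlim (formRightAct a Φ)) ?_
    refine (hlim (formLeftAct a Φ)).congr fun U => ?_
    exact congrArg (fun N : StrongDual ℂ (weakStarForms (MeasureAlgebra G)) => N Φ)
      (leftAct_averagedDiagonal m (φ U) a).symm
  · rw [diag_eq_dirac_one, mul_dirac_one]
    intro f
    -- The values on `diagAdjoint` already converge along `l`, which is coarser than `u`.
    refine tendsto_nhds_unique (hlim _) (Tendsto.mono_left ?_ (Ultrafilter.of_le l))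
    refine Metric.tendsto_nhds.2 fun ε hε => ?_
    -- Small `U` lie inside the set of `x` satisfying the uniform bound; `ε / 2` turns a weak
    -- inequality into the strict one required.
    have hs := eventually_smallSets.2 ⟨_, eventually_norm_conjPullback_sub_le f (half_pos hε),
      fun t ht => ht⟩
    filter_upwards [preimage_mem_comap hs] with U hU
    rw [dist_eq_norm]
    exact (norm_averagedDiagonal_diagAdjoint_sub_le m (hφ U) (hφ' U)
      fun x hx => hU (hφU U x hx)).trans_lt (half_lt_self hε)

end Haar

end MeasureAlgebra

end

theorem proposition3p3 (G : Type*) [Group G] [TopologicalSpace G] [IsTopologicalGroup G]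
    [CompactSpace G] [T2Space G] [MeasurableSpace G] [BorelSpace G] :
    ∃ M : StrongDual ℂ (DualBanachAlgebra.weakStarForms (MeasureAlgebra G)),
      DualBanachAlgebra.IsNormalVirtualDiagonal M := by
  -- Taking the whole group as reference compact set normalises Haar measure to total mass one.
  let m : Measure G := Measure.haarMeasure ⊤
  have : IsProbabilityMeasure m := ⟨Measure.haarMeasure_self⟩
  exact MeasureAlgebra.exists_isNormalVirtualDiagonal m
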